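/- Let $n\ge 1$, let $S\subseteq\mathbb{R}^n$ be a measurable set of positive Lebesgue measure, and write $\langle f\rangle=\int_S f\,dx$. For $\gamma>0$ let $\mathcal{P}_\gamma$ be the set of probability densities $p$ on $S$ with $\langle p^{1+\gamma}\rangle<\infty$, and $\|p\|_{1+\gamma}=\langle p^{1+\gamma}\rangle^{1/(1+\gamma)}$. For $q,p\in\mathcal{P}_\gamma$, $\gamma>0$, define the following cross-entropies (each determines the divergence $D(q,p)=d(q,p)-d(q,q)$). * NB-DPD (norm-based Bregman density power): for functions $\phi_g:[0,\infty)\to\mathbb{R}$ $(g\ge 0)$, each strictly increasing, convex, and differentiable on $(0,\infty)$, $$d^{\rm NB}_{\phi,\gamma}(q,p)=-\frac{\phi_\gamma(\|p\|_{1+\gamma})-\phi_0(1)}{\gamma}-\frac{\phi_\gamma'(\|p\|_{1+\gamma})\,(\langle qp^\gamma\rangle-\langle p^{1+\gamma}\rangle)}{\gamma\,\|p\|_{1+\gamma}^{\gamma}}.$$ For $\gamma=0$, with $g\mapsto\phi_g(1)$ moreover differentiable from the right at $0$, $$d^{\rm NB}_{\phi,0}(q,p)=-\phi_0'(1)\langle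 q\log p\rangle-\partial_g\phi_g(1)|_{g=0},$$ for densities $q,p$ such that $q=0$ a.e. on $\{p=0\}$ and $q\log p$ is integrable. * Hölder: for $H:[0,\infty)\to\mathbb{R}$ with $H(z)\ge -z^{1+\gamma}$ for all $z\ge0$ and $H(1)=-1$, $$d_{H,\gamma}(q,p)=\frac1\gamma H\!\left(\frac{\langle qp^\gamma\rangle}{\langle p^{1+\gamma}\rangle}\right)\langle p^{1+\gamma}\rangle+\frac1\gamma .$$ * Bregman–Hölder: for $\kappa\ge1$, $$d^{\rm BH}_{\kappa,\gamma}(q,p)=\frac{\kappa}{\gamma}\|p\|_{1+\gamma}^{\kappa}\left(1-\frac1\kappa-\frac{\langle qp^\gamma\rangle}{\langle p^{1+\gamma}\rangle}\right)+\frac1\gamma .$$ Call $d$ and $\tilde d$ equivalent if $\tilde d(q,p)=\xi(d(q,p))$, for all pairs $(q,p)$ at which both are defined, with some strictly increasing $\xi:\mathbb{R}\to\mathbb{R}$; call them weakly equivalent if $\xi$ is only required to be strictly increasing on the set of values of $d$ at these pairs. **Corollary 1.** Up to equivalence, the intersection of the NB-DPD class and the Hölder class is exactly the Bregman–Hölder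 class: 1. If $\gamma\ge0$, $\gamma'>0$, and $\phi$, $H$ are as above (for $\gamma$ and $\gamma'$, respectively) with $d^{\rm NB}_{\phi,\gamma}$ weakly equivalent to $d_{H,\gamma'}$, then $\gamma=\gamma'$ and there is $\kappa\ge1$ such that $d^{\rm BH}_{\kappa,\gamma}$ is equivalent to $d^{\rm NB}_{\phi,\gamma}$. 2. Conversely, for all $\gamma>0$ and $\kappa\ge1$ there are $\phi$ and $H$ as above such that $d^{\rm BH}_{\kappa,\gamma}$ is equivalent to $d^{\rm NB}_{\phi,\gamma}$ and to $d_{H,\gamma}$. -/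

import Mathlib

open MeasureTheory

namespace NBDPD

noncomputable section

variable {X : Type*} [MeasurableSpace X]

/-- `p` is a probability density with respect to `ν`. -/
structure IsDensity (ν : Measure X) (p : X → ℝ) : Prop where
  nonneg : 0 ≤ᵐ[ν] p
  integrable : Integrable p ν
  integral_eq_one : ∫ x, p x ∂ν = 1

/-- The probability densities `p` with `⟨p ^ (1 + γ)⟩ < ∞`. -/
def DensityClass (ν : Measure X) (γ : ℝ) : Set (X → ℝ) :=
  {p | IsDensity ν p ∧ Integrable (fun x => p x ^ (1 + γ)) ν}

/-- `⟨p ^ (1 + γ)⟩`. -/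
def powInt (ν : Measure X) (γ : ℝ) (p : X → ℝ) : ℝ :=
  ∫ x, p x ^ (1 + γ) ∂ν

/-- `⟨q p ^ γ⟩`. -/
def crossInt (ν : Measure X) (γ : ℝ) (q p : X → ℝ) : ℝ :=
  ∫ x, q x * p x ^ γ ∂ν

/-- The `L_{1+γ}` norm of a density. -/
def lnorm (ν : Measure X) (γ : ℝ) (p : X → ℝ) : ℝ :=
  powInt ν γ p ^ (1 / (1 + γ))

/-- A real functional of an ordered pair `(q, p)` of densities, together with the set of pairs
at which it is defined (all integrals in its formula converge). -/
structure PairFunctional (X : Type*) where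
  dom : Set ((X → ℝ) × (X → ℝ))
  val : (X → ℝ) → (X → ℝ) → ℝ

/-- Equivalence of cross-entropies: `d' = ξ ∘ d` for a strictly increasing `ξ : ℝ → ℝ`, at all
pairs of densities where both are defined. -/
def Equivalent (d d' : PairFunctional X) : Prop :=
  ∃ ξ : ℝ → ℝ, StrictMono ξ ∧
    ∀ q p, (q, p) ∈ d.dom → (q, p) ∈ d'.dom → d'.val q p = ξ (d.val q p)

/-- Equivalence where `ξ` need be strictly increasing only on the values which `d` attains.
This admits transformations such as a logarithm, which do not extend to an increasing function
on all of `ℝ`, and it is symmetric in `d` and `d'`. -/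
def WeaklyEquivalent (d d' : PairFunctional X) : Prop :=
  ∃ ξ : ℝ → ℝ,
    StrictMonoOn ξ {y | ∃ q p, (q, p) ∈ d.dom ∧ (q, p) ∈ d'.dom ∧ d.val q p = y} ∧
    ∀ q p, (q, p) ∈ d.dom → (q, p) ∈ d'.dom → d'.val q p = ξ (d.val q p)

/-- The family `γ ↦ φ γ` generates a norm-based Bregman density power cross-entropy with power
parameter `γ`. Each `φ g : ℝ₊ → ℝ` is strictly increasing, convex and differentiable; only its
values on `[0, ∞)` matter. The parameter derivative enters the cross-entropy for `γ = 0` only. -/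
structure IsNBGenerator (φ : ℝ → ℝ → ℝ) (γ : ℝ) : Prop where
  strictMonoOn : ∀ g, 0 ≤ g → StrictMonoOn (φ g) (Set.Ici 0)
  convexOn : ∀ g, 0 ≤ g → ConvexOn ℝ (Set.Ici 0) (φ g)
  differentiableOn : ∀ g, 0 ≤ g → DifferentiableOn ℝ (φ g) (Set.Ioi 0)
  param_differentiable : γ = 0 →
    DifferentiableWithinAt ℝ (fun g => φ g 1) (Set.Ici 0) 0

open Classical in
/-- Norm-based Bregman density power cross-entropy. For `γ = 0` it is an affine function of the
Shannon cross-entropy `-⟨q log p⟩`, which is finite if `q` vanishes where `p` does and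
`q log p` is integrable. -/
def nbCE (ν : Measure X) (φ : ℝ → ℝ → ℝ) (γ : ℝ) : PairFunctional X where
  dom := if γ = 0 then
      {z | IsDensity ν z.1 ∧ IsDensity ν z.2 ∧ (∀ᵐ x ∂ν, z.2 x = 0 → z.1 x = 0) ∧
        Integrable (fun x => z.1 x * Real.log (z.2 x)) ν}
    else DensityClass ν γ ×ˢ DensityClass ν γ
  val q p := if γ = 0 then
      -(deriv (φ 0) 1 * ∫ x, q x * Real.log (p x) ∂ν)
        - derivWithin (fun g => φ g 1) (Set.Ici 0) 0
    else
      -((φ γ (lnorm ν γ p) - φ 0 1) / γ)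
        - deriv (φ γ) (lnorm ν γ p) * (crossInt ν γ q p - powInt ν γ p)
            / (γ * lnorm ν γ p ^ γ)

/-- The functions `H : ℝ₊ → ℝ` which define Hölder cross-entropies with parameter `γ`. -/
structure IsHolderGenerator (H : ℝ → ℝ) (γ : ℝ) : Prop where
  lower_bound : ∀ z, 0 ≤ z → -z ^ (1 + γ) ≤ H z
  at_one : H 1 = -1

/-- Hölder cross-entropy, `γ > 0`. -/
def holderCE (ν : Measure X) (H : ℝ → ℝ) (γ : ℝ) : PairFunctional X where
  dom := DensityClass ν γ ×ˢ DensityClass ν γ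
  val q p := 1 / γ * H (crossInt ν γ q p / powInt ν γ p) * powInt ν γ p + 1 / γ

/-- Bregman–Hölder cross-entropy, `γ > 0`, `κ ≥ 1`. -/
def bregmanHolderCE (ν : Measure X) (κ γ : ℝ) : PairFunctional X where
  dom := DensityClass ν γ ×ˢ DensityClass ν γ
  val q p := κ / γ * lnorm ν γ p ^ κ * (1 - 1 / κ - crossInt ν γ q p / powInt ν γ p) + 1 / γ

end

end NBDPD

/-!
Write `N = ‖p‖_{1+γ}` and `ζ = ⟨q p ^ γ⟩ / ⟨p ^ (1 + γ)⟩`. Up to constants, the norm-based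
cross-entropy is minus the value at `N ζ` of the tangent line to `φ = φ_γ` at `N`, Hölder's is
`N ^ (1 + γ) * H ζ`, and the Bregman–Hölder one is the norm-based one with `φ x = x ^ κ`. Without
atoms all `ζ ≥ 0` and all norms above that of the uniform density occur independently.

Let `γ = γ'`. The pairs `(N, ζ)` and `(t N, 1)` lie on the same Hölder level when
`H ζ = t ^ (1 + γ) * H 1`, a condition on `ζ` and `t` only. On the norm-based side they lie on the
same level when `φ (t N) - φ N = N φ' N (ζ - 1)`, so this ratio `ζ - 1` depends on `t` only. The
resulting dilation equation makes `N φ' N` an affine function of `φ N`. Hence `φ` is affine in a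
power `N ^ κ`, with `κ ≥ 1` by convexity; continuity extends this to the uniform density.

For fixed `p` both cross-entropies depend on `q` only through its means of `p ^ γ` (of `log p` if
`γ = 0`) and of `p ^ γ'`, respectively. If `γ ≠ γ'` then strict convexity or concavity of one of
these functions in terms of the other gives two densities `q` which only one of these means
distinguishes.

Conversely, `N ^ κ (1 + κ (ζ - 1))` becomes `N ^ (1 + γ)` times a function of `ζ` when raised to
the power `(1 + γ) / κ`; the sign of the second factor requires the odd extension of this power,
and Bernoulli's inequality bounds the function of `ζ` by `ζ ^ (1 + γ)`.
-/

namespace NBDPD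

open Set Filter Topology
open scoped ENNReal

section IntermediateMeasures

variable {X : Type*} [MeasurableSpace X] {ν : Measure X}

/-- `ν` takes on the measurable subsets of every measurable set `T` all values below `ν T`: the
form in which the absence of atoms is used to construct densities. -/
def HasIntermediateMeasures (ν : Measure X) : Prop :=
  ∀ T, MeasurableSet T → ∀ t < ν T, ∃ A ⊆ T, MeasurableSet A ∧ ν A = t

theorem continuous_measureReal_Iic (ρ : Measure ℝ) [IsFiniteMeasure ρ] [NullSingletonClass ρ] :
    Continuous fun b => ρ.real (Iic b) := by
  have h := fun a : ℝ =>
    (integrableOn_const (C := (1 : ℝ)) (measure_ne_top ρ (Iic a))).continuousOn_Iic_primitive_Iic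
  simp only [setIntegral_const, smul_eq_mul, mul_one] at h
  exact continuous_iff_continuousAt.2 fun b =>
    (h (b + 1)).continuousAt (Iic_mem_nhds (lt_add_one b))

theorem exists_measure_Iic_eq (ρ : Measure ℝ) [IsFiniteMeasure ρ] [NullSingletonClass ρ]
    {t : ℝ≥0∞} (ht : 0 < t) (ht' : t < ρ univ) : ∃ b, ρ (Iic b) = t := by
  have hbot : ∃ a, ρ (Iic a) ≤ t := by
    have h : Tendsto (fun a => ρ (Iic a)) atBot (𝓝 0) := by
      have hinter : ⋂ a : ℝ, Iic a = ∅ :=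
        iInter_Iic_eq_empty_iff.2 (by simp [not_bddBelow_univ])
      rw [← measure_empty (μ := ρ), ← hinter]
      exact tendsto_measure_iInter_atBot (fun a => measurableSet_Iic.nullMeasurableSet)
        (fun _ _ => Iic_subset_Iic.2) ⟨0, measure_ne_top ρ _⟩
    exact (h.eventually_le_const ht).exists
  have htop : ∃ a, t ≤ ρ (Iic a) :=
    ((tendsto_measure_Iic_atTop ρ).eventually_const_le ht').exists
  have hcont : Continuous fun b => ρ (Iic b) := by
    simpa only [Function.comp_def, ofReal_measureReal (measure_ne_top ρ _)] using
      ENNReal.continuous_ofReal.comp (continuous_measureReal_Iic ρ)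
  exact mem_range_of_exists_le_of_exists_ge hcont hbot htop

theorem hasIntermediateMeasures_of_null_fibers [SigmaFinite ν] {f : X → ℝ} (hf : Measurable f)
    (hnull : ∀ r, ν (f ⁻¹' {r}) = 0) : HasIntermediateMeasures ν := by
  intro T hT t ht
  rcases eq_zero_or_pos t with rfl | ht0
  · exact ⟨∅, empty_subset _, .empty, measure_empty⟩
  obtain ⟨U, hU, hUT, htU, hUtop⟩ := ν.exists_subset_measure_lt_top hT ht
  have : Fact (ν U < ∞) := ⟨hUtop⟩
  have : NullSingletonClass ((ν.restrict U).map f) := ⟨fun r => by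
    rw [Measure.map_apply hf (measurableSet_singleton r)]
    exact Measure.restrict_le_self.absolutelyContinuous (hnull r)⟩
  obtain ⟨b, hb⟩ := exists_measure_Iic_eq ((ν.restrict U).map f) ht0 (by
    rwa [Measure.map_apply hf .univ, preimage_univ, Measure.restrict_apply_univ])
  refine ⟨f ⁻¹' Iic b ∩ U, inter_subset_right.trans hUT, (hf measurableSet_Iic).inter hU, ?_⟩
  rwa [Measure.map_apply hf measurableSet_Iic, Measure.restrict_apply (hf measurableSet_Iic)] at hb

theorem hasIntermediateMeasures_addHaar_restrict {E : Type*} [NormedAddCommGroup E]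
    [NormedSpace ℝ E] [FiniteDimensional ℝ E] [Nontrivial E] [MeasurableSpace E] [BorelSpace E]
    (μ : Measure E) [μ.IsAddHaarMeasure] (S : Set E) : HasIntermediateMeasures (μ.restrict S) :=
  hasIntermediateMeasures_of_null_fibers measurable_norm fun r =>
    Measure.restrict_le_self.absolutelyContinuous <| by
      convert μ.addHaar_sphere 0 r using 2
      ext x
      simp

theorem HasIntermediateMeasures.exists_pairwiseDisjoint_measure_eq
    (hν : HasIntermediateMeasures ν) {ι : Type*} (s : Finset ι) (m : ι → ℝ≥0∞)
    (hm : ∑ i ∈ s, m i < ν univ) :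
    ∃ A : ι → Set X, (∀ i ∈ s, MeasurableSet (A i)) ∧ (s : Set ι).PairwiseDisjoint A ∧
      ∀ i ∈ s, ν (A i) = m i := by
  classical
  induction s using Finset.induction_on with
  | empty => exact ⟨fun _ => ∅, by simp⟩
  | insert i s hi ih =>
    rw [Finset.sum_insert hi] at hm
    obtain ⟨A, hA, hdisj, hAm⟩ := ih (le_add_self.trans_lt hm)
    set U := ⋃ j ∈ s, A j with hU
    have hUmeas : MeasurableSet U := s.measurableSet_biUnion hA
    have hroom : m i < ν Uᶜ := by
      rw [← measure_add_measure_compl hUmeas, measure_biUnion_finset hdisj hA,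
        Finset.sum_congr rfl hAm, add_comm] at hm
      exact lt_of_add_lt_add_left hm
    obtain ⟨B, hBU, hB, hBm⟩ := hν Uᶜ hUmeas.compl (m i) hroom
    have hBA : ∀ j ∈ s, Disjoint B (A j) := fun j hj =>
      disjoint_of_subset hBU (subset_biUnion_of_mem (u := A) hj) disjoint_compl_left
    have hne : ∀ j ∈ s, j ≠ i := fun j hj hji => hi (hji ▸ hj)
    refine ⟨Function.update A i B, ?_, ?_, ?_⟩
    · simpa +contextual [hB, hne] using hA
    · rw [Finset.coe_insert, pairwiseDisjoint_insert_of_notMem (by exact_mod_cast hi)]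
      refine ⟨?_, ?_⟩
      · intro j hj k hk hjk
        simpa [Function.onFun, hne j hj, hne k hk] using hdisj hj hk hjk
      · intro j hj
        simpa [hne j hj] using hBA j hj
    · simpa +contextual [hBm, hne] using hAm

end IntermediateMeasures

section Mixtures

variable {X ι : Type*} [MeasurableSpace X] {ν : Measure X}

/-- Disjoint measurable sets of positive finite measure, carrying the densities with which the
cross-entropies are tested. -/
structure IsDisjointCells (ν : Measure X) (A : ι → Set X) : Prop where
  measurableSet : ∀ i, MeasurableSet (A i)
  pairwise_disjoint : Pairwise (Function.onFun Disjoint A)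
  measureReal_pos : ∀ i, 0 < ν.real (A i)

theorem HasIntermediateMeasures.exists_isDisjointCells [Fintype ι]
    (hν : HasIntermediateMeasures ν) {m : ι → ℝ} (hm : ∀ i, 0 < m i)
    (hmν : ENNReal.ofReal (∑ i, m i) < ν univ) :
    ∃ A : ι → Set X, IsDisjointCells ν A ∧ ∀ i, ν.real (A i) = m i := by
  rw [ENNReal.ofReal_sum_of_nonneg fun i _ => (hm i).le] at hmν
  obtain ⟨A, hA, hdisj, hAm⟩ :=
    hν.exists_pairwiseDisjoint_measure_eq Finset.univ (fun i => ENNReal.ofReal (m i)) hmν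
  have hreal : ∀ i, ν.real (A i) = m i := fun i => by
    rw [measureReal_def, hAm i (Finset.mem_univ i), ENNReal.toReal_ofReal (hm i).le]
  rw [Finset.coe_univ, PairwiseDisjoint, pairwise_univ] at hdisj
  exact ⟨A, ⟨fun i => hA i (Finset.mem_univ i), hdisj, fun i => hreal i ▸ hm i⟩, hreal⟩

theorem IsDisjointCells.integrable_indicator_const {A : ι → Set X} (hA : IsDisjointCells ν A)
    (i : ι) (c : ℝ) : Integrable ((A i).indicator fun _ => c) ν :=
  (integrable_indicator_iff (hA.measurableSet i)).2
    (integrableOn_const (ENNReal.toReal_pos_iff.1 (hA.measureReal_pos i)).2.ne)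

variable [Fintype ι] {A : ι → Set X} {w u : ι → ℝ} {γ : ℝ}

/-- The mixture with weights `w` of the uniform densities on the sets `A i`. -/
noncomputable def mixture (ν : Measure X) (A : ι → Set X) (w : ι → ℝ) (x : X) : ℝ :=
  ∑ i, (A i).indicator (fun _ => w i / ν.real (A i)) x

theorem mixture_nonneg (hw : ∀ i, 0 ≤ w i) (x : X) : 0 ≤ mixture ν A w x :=
  Finset.sum_nonneg fun i _ => indicator_nonneg (fun _ _ => div_nonneg (hw i) measureReal_nonneg) x

theorem mixture_of_forall_notMem {x : X} (hx : ∀ i, x ∉ A i) : mixture ν A w x = 0 :=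
  Finset.sum_eq_zero fun i _ => indicator_of_notMem (hx i) _

namespace IsDisjointCells

variable (hA : IsDisjointCells ν A)

include hA

theorem mixture_of_mem {i : ι} {x : X} (hx : x ∈ A i) : mixture ν A w x = w i / ν.real (A i) := by
  refine (Finset.sum_eq_single_of_mem i (Finset.mem_univ i) fun j _ hji => ?_).trans
    (indicator_of_mem hx _)
  exact indicator_of_notMem (disjoint_right.1 (hA.pairwise_disjoint hji) hx) _

theorem mixture_mul_comp (G : ℝ → ℝ) (x : X) :
    mixture ν A w x * G (mixture ν A u x) =
      mixture ν A (fun i => w i * G (u i / ν.real (A i))) x := by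
  by_cases hx : ∃ i, x ∈ A i
  · obtain ⟨i, hi⟩ := hx
    simp only [hA.mixture_of_mem hi]
    ring
  · rw [not_exists] at hx
    simp only [mixture_of_forall_notMem hx, zero_mul]

theorem integrable_mixture : Integrable (mixture ν A w) ν :=
  integrable_finsetSum _ fun i _ => hA.integrable_indicator_const i _

theorem integral_mixture : ∫ x, mixture ν A w x ∂ν = ∑ i, w i := by
  simp only [mixture]
  rw [integral_finsetSum _ fun i _ => hA.integrable_indicator_const i _]
  refine Finset.sum_congr rfl fun i _ => ?_
  rw [integral_indicator_const _ (hA.measurableSet i), smul_eq_mul,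
    mul_div_cancel₀ _ (hA.measureReal_pos i).ne']

theorem integrable_mixture_mul_comp (G : ℝ → ℝ) :
    Integrable (fun x => mixture ν A w x * G (mixture ν A u x)) ν := by
  simpa only [hA.mixture_mul_comp] using hA.integrable_mixture

theorem integral_mixture_mul_comp (G : ℝ → ℝ) :
    ∫ x, mixture ν A w x * G (mixture ν A u x) ∂ν = ∑ i, w i * G (u i / ν.real (A i)) := by
  simp only [hA.mixture_mul_comp, hA.integral_mixture]

theorem isDensity_mixture (hw : w ∈ stdSimplex ℝ ι) : IsDensity ν (mixture ν A w) :=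
  ⟨.of_forall (mixture_nonneg hw.1), hA.integrable_mixture, hA.integral_mixture.trans hw.2⟩

theorem mixture_mem_densityClass (hγ : 0 < γ) (hw : w ∈ stdSimplex ℝ ι) :
    mixture ν A w ∈ DensityClass ν γ := by
  refine ⟨hA.isDensity_mixture hw, ?_⟩
  simpa only [Real.rpow_one_add' (mixture_nonneg hw.1 _) (by positivity : 1 + γ ≠ 0)] using
    hA.integrable_mixture_mul_comp (· ^ γ)

theorem crossInt_mixture :
    crossInt ν γ (mixture ν A w) (mixture ν A u) = ∑ i, w i * (u i / ν.real (A i)) ^ γ :=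
  hA.integral_mixture_mul_comp (· ^ γ)

end IsDisjointCells

end Mixtures

section Norms

variable {X : Type*} [MeasurableSpace X] {ν : Measure X} {γ : ℝ} {p : X → ℝ}

theorem crossInt_self (hγ : 0 < γ) (hp : IsDensity ν p) : crossInt ν γ p p = powInt ν γ p :=
  integral_congr_ae <| hp.nonneg.mono fun _ hx =>
    (Real.rpow_one_add' hx (by positivity)).symm

theorem powInt_nonneg (hp : IsDensity ν p) : 0 ≤ powInt ν γ p :=
  integral_nonneg_of_ae <| hp.nonneg.mono fun _ hx => Real.rpow_nonneg hx _

theorem powInt_pos (hγ : 0 < γ) (hp : p ∈ DensityClass ν γ) : 0 < powInt ν γ p := by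
  refine (powInt_nonneg hp.1).lt_of_ne fun h => zero_ne_one (α := ℝ) ?_
  have hpow := (integral_eq_zero_iff_of_nonneg_ae
    (hp.1.nonneg.mono fun _ hx => Real.rpow_nonneg hx _) hp.2).1 h.symm
  have hzero : p =ᵐ[ν] 0 := by
    filter_upwards [hpow, hp.1.nonneg] with x hx hx0
    exact (Real.rpow_eq_zero hx0 (by positivity)).1 hx
  rw [← hp.1.integral_eq_one, integral_congr_ae hzero, Pi.zero_def, integral_zero]

theorem lnorm_pos (hγ : 0 < γ) (hp : p ∈ DensityClass ν γ) : 0 < lnorm ν γ p :=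
  Real.rpow_pos_of_pos (powInt_pos hγ hp) _

theorem lnorm_rpow (hγ : 0 < γ) (hp : IsDensity ν p) : lnorm ν γ p ^ (1 + γ) = powInt ν γ p := by
  rw [lnorm, one_div, Real.rpow_inv_rpow (powInt_nonneg hp) (by positivity)]

/-- The smallest value of `lnorm ν γ` on densities, namely that of the uniform density. If `ν` is
infinite then the junk values `ν.real univ = 0` and `0 ^ (-γ) = 0` give the infimum `0`. -/
noncomputable def minNorm (ν : Measure X) (γ : ℝ) : ℝ :=
  (ν.real univ ^ (-γ)) ^ (1 / (1 + γ))

theorem minNorm_nonneg : 0 ≤ minNorm ν γ :=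
  Real.rpow_nonneg (Real.rpow_nonneg measureReal_nonneg _) _

theorem measureReal_univ_rpow_neg_le_powInt (hγ : 0 < γ) (hp : p ∈ DensityClass ν γ) :
    ν.real univ ^ (-γ) ≤ powInt ν γ p := by
  by_cases h : ν univ = ∞
  · rw [measureReal_def, h, ENNReal.toReal_top, Real.zero_rpow (neg_ne_zero.2 hγ.ne')]
    exact powInt_nonneg hp.1
  have : IsFiniteMeasure ν := ⟨lt_top_iff_ne_top.2 h⟩
  have : NeZero ν := ⟨by
    rintro rfl
    simpa using hp.1.integral_eq_one⟩
  have hM : 0 < ν.real univ := measureReal_univ_pos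
  have hjensen := (convexOn_rpow (by linarith : 1 ≤ 1 + γ)).map_average_le
    (Real.continuous_rpow_const (by positivity)).continuousOn isClosed_Ici hp.1.nonneg
    hp.1.integrable hp.2
  rw [average_eq, average_eq, hp.1.integral_eq_one, smul_eq_mul, smul_eq_mul, mul_one,
    Real.rpow_one_add' (by positivity) (by positivity), Real.inv_rpow hM.le,
    ← Real.rpow_neg hM.le] at hjensen
  exact le_of_mul_le_mul_left hjensen (inv_pos.2 hM)

theorem minNorm_le_lnorm (hγ : 0 < γ) (hp : p ∈ DensityClass ν γ) : minNorm ν γ ≤ lnorm ν γ p :=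
  Real.rpow_le_rpow (Real.rpow_nonneg measureReal_nonneg _)
    (measureReal_univ_rpow_neg_le_powInt hγ hp) (by positivity)

theorem exists_rpow_neg_lt_of_measureReal_univ (hν0 : ν ≠ 0) (hγ : 0 < γ) {P : ℝ}
    (hP : ν.real univ ^ (-γ) < P) :
    ∃ m, 0 < m ∧ ENNReal.ofReal m < ν univ ∧ m ^ (-γ) < P := by
  by_cases h : ν univ = ∞
  · rw [measureReal_def, h, ENNReal.toReal_top, Real.zero_rpow (neg_ne_zero.2 hγ.ne')] at hP
    obtain ⟨m, hm, hmP⟩ := ((eventually_gt_atTop 0).and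
      ((tendsto_rpow_neg_atTop hγ).eventually_lt_const hP)).exists
    exact ⟨m, hm, h ▸ ENNReal.ofReal_lt_top, hmP⟩
  · have hM : 0 < ν.real univ :=
      ENNReal.toReal_pos (fun h0 => hν0 (Measure.measure_univ_eq_zero.1 h0)) h
    have hcont := (Real.continuousAt_rpow_const _ (-γ) (.inl hM.ne')).eventually_lt_const hP
    obtain ⟨m, ⟨hm, hmM⟩, hmP⟩ :=
      (Filter.Eventually.and (Ioo_mem_nhdsLT hM) (hcont.filter_mono nhdsWithin_le_nhds)).exists
    exact ⟨m, hm, (ENNReal.ofReal_lt_iff_lt_toReal hm.le h).2 hmM, hmP⟩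

theorem exists_spike_weight {m P v : ℝ} (hγ : 0 < γ) (hm : 0 < m) (hmP : m ^ (-γ) < P)
    (hPv : P < v ^ γ) :
    ∃ θ ∈ Ioo (0 : ℝ) 1, (1 - θ) * ((1 - θ) / m) ^ γ + θ * v ^ γ = P := by
  refine intermediate_value_Ioo zero_le_one (Continuous.continuousOn ?_) ⟨?_, ?_⟩
  · have : Continuous fun θ : ℝ => ((1 - θ) / m) ^ γ :=
      Continuous.rpow_const (by fun_prop) fun _ => .inr hγ.le
    fun_prop
  · simpa [Real.inv_rpow hm.le, ← Real.rpow_neg hm.le] using hmP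
  · simpa using hPv

/-- A high spike on a small cell gives `p` the required norm. Moving mass of `q` between the spike
and a cell where `p` vanishes then gives `⟨q p ^ γ⟩` any value up to that on the spike. -/
theorem exists_powInt_eq_crossInt_eq (hν : HasIntermediateMeasures ν) {m P Q : ℝ} (hγ : 0 < γ)
    (hm : 0 < m) (hmν : ENNReal.ofReal m < ν univ) (hmP : m ^ (-γ) < P) (hQ : 0 ≤ Q) :
    ∃ q p, q ∈ DensityClass ν γ ∧ p ∈ DensityClass ν γ ∧ powInt ν γ p = P ∧
      crossInt ν γ q p = Q := by
  obtain ⟨m', _, hmm', hm'ν⟩ := ENNReal.lt_iff_exists_real_btwn.1 hmν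
  rw [ENNReal.ofReal_lt_ofReal_iff_of_nonneg hm.le] at hmm'
  obtain ⟨r, hr, hmr⟩ : ∃ r > 0, m + r + r = m' := ⟨(m' - m) / 2, by linarith, by ring⟩
  obtain ⟨v, ⟨hPv, hQv⟩, hv, hvr⟩ : ∃ v : ℝ, (P < v ^ γ ∧ Q ≤ v ^ γ) ∧ 0 < v ∧ 1 / r ≤ v :=
    ((((tendsto_rpow_atTop hγ).eventually_gt_atTop P).and
      ((tendsto_rpow_atTop hγ).eventually_ge_atTop Q)).and
      ((eventually_gt_atTop 0).and (eventually_ge_atTop (1 / r)))).exists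
  obtain ⟨θ, ⟨hθ0, hθ1⟩, hθ⟩ := exists_spike_weight hγ hm hmP hPv
  have hvγ : 0 < v ^ γ := Real.rpow_pos_of_pos hv γ
  have hθr : θ / v ≤ r := by
    rw [div_le_iff₀ hv]
    rw [div_le_iff₀' hr] at hvr
    linarith
  obtain ⟨A, hA, hAm⟩ := hν.exists_isDisjointCells (m := ![m, θ / v, r])
    (by simp [Fin.forall_fin_succ, hm, hr, div_pos hθ0 hv])
    ((ENNReal.ofReal_le_ofReal (by simp [Fin.sum_univ_three]; linarith)).trans_lt hm'ν)
  have hq : ![0, Q / v ^ γ, 1 - Q / v ^ γ] ∈ stdSimplex ℝ (Fin 3) :=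
    ⟨by simp [Fin.forall_fin_succ, div_nonneg hQ hvγ.le, div_le_one hvγ, hQv],
      by simp [Fin.sum_univ_three]⟩
  have hp : ![1 - θ, θ, 0] ∈ stdSimplex ℝ (Fin 3) :=
    ⟨by simp [Fin.forall_fin_succ, hθ0.le, hθ1.le], by simp [Fin.sum_univ_three]⟩
  refine ⟨_, _, hA.mixture_mem_densityClass hγ hq, hA.mixture_mem_densityClass hγ hp, ?_, ?_⟩
  · rw [← crossInt_self hγ (hA.isDensity_mixture hp), hA.crossInt_mixture, ← hθ]
    simp [Fin.sum_univ_three, hAm, div_div_cancel₀ hθ0.ne']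
  · rw [hA.crossInt_mixture]
    simp [Fin.sum_univ_three, hAm, div_div_cancel₀ hθ0.ne', Real.zero_rpow hγ.ne', hvγ.ne']

theorem exists_lnorm_eq_crossInt_div_powInt_eq (hν : HasIntermediateMeasures ν) (hν0 : ν ≠ 0)
    (hγ : 0 < γ) {N ζ : ℝ} (hN : minNorm ν γ < N) (hζ : 0 ≤ ζ) :
    ∃ q p, q ∈ DensityClass ν γ ∧ p ∈ DensityClass ν γ ∧ lnorm ν γ p = N ∧
      crossInt ν γ q p / powInt ν γ p = ζ := by
  have hN0 : 0 < N := minNorm_nonneg.trans_lt hN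
  have hP : ν.real univ ^ (-γ) < N ^ (1 + γ) := by
    rwa [minNorm, one_div, Real.rpow_inv_lt_iff_of_pos (Real.rpow_nonneg measureReal_nonneg _)
      hN0.le (by positivity)] at hN
  obtain ⟨m, hm, hmν, hmP⟩ := exists_rpow_neg_lt_of_measureReal_univ hν0 hγ hP
  have hP0 : 0 < N ^ (1 + γ) := Real.rpow_pos_of_pos hN0 _
  obtain ⟨q, p, hq, hp, hpow, hcross⟩ :=
    exists_powInt_eq_crossInt_eq hν hγ hm hmν hmP (mul_nonneg hζ hP0.le)
  refine ⟨q, p, hq, hp, ?_, ?_⟩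
  · rw [lnorm, hpow, one_div, Real.rpow_rpow_inv hN0.le (by positivity)]
  · rw [hpow, hcross, mul_div_cancel_right₀ _ hP0.ne']

end Norms

section PowerLaw

variable {φ : ℝ → ℝ} {c x : ℝ}

/-- The value at `x * ζ` of the tangent line to `φ` at `x`. Up to constants, a norm-based
cross-entropy is a tangent value at the norm of `p`. -/
noncomputable def tangentValue (φ : ℝ → ℝ) (x ζ : ℝ) : ℝ :=
  φ x + x * deriv φ x * (ζ - 1)

theorem tangentValue_one (φ : ℝ → ℝ) (x : ℝ) : tangentValue φ x 1 = φ x := by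
  simp [tangentValue]

theorem tangentValue_injective (hx : x * deriv φ x ≠ 0) : (tangentValue φ x).Injective :=
  fun _ _ h => sub_left_injective (mul_left_cancel₀ hx (add_left_cancel h))

theorem deriv_pos_of_convexOn (hconv : ConvexOn ℝ (Ici 0) φ) (hmono : StrictMonoOn φ (Ici 0))
    (hx : 0 < x) (hd : DifferentiableAt ℝ φ x) : 0 < deriv φ x := by
  refine lt_of_lt_of_le ?_ (hconv.slope_le_deriv self_mem_Ici hx.le hx hd)
  rw [slope_def_field]
  exact div_pos (sub_pos.2 (hmono self_mem_Ici hx.le hx)) (sub_pos.2 hx)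

theorem add_deriv_mul_sub_le_of_convexOn {s : Set ℝ} (hconv : ConvexOn ℝ s φ) (hx : x ∈ s)
    (hd : DifferentiableAt ℝ φ x) {y : ℝ} (hy : y ∈ s) :
    φ x + deriv φ x * (y - x) ≤ φ y := by
  rcases lt_trichotomy x y with hxy | rfl | hyx
  · have hslope := hconv.deriv_le_slope hx hy hxy hd
    rw [slope_def_field, le_div_iff₀ (sub_pos.2 hxy)] at hslope
    linarith
  · simp
  · have hslope := hconv.slope_le_deriv hy hx hyx hd
    rw [slope_def_field, div_le_iff₀ (sub_pos.2 hyx)] at hslope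
    linarith

theorem exists_tangentValue_eq (hconv : ConvexOn ℝ (Ici 0) φ) (hx : 0 < x)
    (hd : DifferentiableAt ℝ φ x) (hpos : 0 < deriv φ x) {y : ℝ} (hy : 0 ≤ y) :
    ∃ ζ, 0 ≤ ζ ∧ tangentValue φ x ζ = φ y := by
  have hslope : 0 < x * deriv φ x := mul_pos hx hpos
  have htangent := add_deriv_mul_sub_le_of_convexOn hconv hx.le hd hy
  refine ⟨1 + (φ y - φ x) / (x * deriv φ x), ?_, ?_⟩
  · rw [← sub_nonneg] at htangent
    rw [one_add_div hslope.ne']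
    refine div_nonneg ?_ hslope.le
    linarith [mul_nonneg hpos.le hy]
  · rw [tangentValue, add_sub_cancel_left, mul_div_cancel₀ _ hslope.ne', add_sub_cancel]

theorem exists_eq_mul_add_of_dilation {ψ : ℝ → ℝ} (hc : 0 ≤ c) (hφ : InjOn φ (Ioi c))
    (h : ∀ x y t, c < x → c < y → c < t * x → c < t * y →
      (φ (t * x) - φ x) * ψ y = (φ (t * y) - φ y) * ψ x) :
    ∃ κ d, ∀ y, c < y → ψ y = κ * φ y + d := by
  obtain ⟨z, hz⟩ : ∃ z, c < z := exists_gt c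
  have hz0 : z ≠ 0 := (hc.trans_lt hz).ne'
  have hne : φ (2 * z) - φ z ≠ 0 := sub_ne_zero.2 fun h =>
    absurd (hφ (show c < 2 * z by linarith) hz h) (by linarith)
  refine ⟨(ψ (2 * z) - ψ z) / (φ (2 * z) - φ z),
    ψ z - (ψ (2 * z) - ψ z) / (φ (2 * z) - φ z) * φ z, fun y hy => ?_⟩
  have hdouble := h z y 2 hz hy (by linarith) (by linarith)
  have hdilate := h z (2 * z) (y / z) hz (by linarith) (by rwa [div_mul_cancel₀ _ hz0])
    (by rw [mul_left_comm, div_mul_cancel₀ _ hz0]; linarith)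
  rw [mul_left_comm, div_mul_cancel₀ _ hz0] at hdilate
  field_simp
  linear_combination hdouble - hdilate

theorem exists_eq_mul_rpow_of_hasDerivAt {χ : ℝ → ℝ} {κ : ℝ} (hc : 0 ≤ c)
    (hχ : ∀ x, c < x → HasDerivAt χ (κ * χ x / x) x) : ∃ b, ∀ x, c < x → χ x = b * x ^ κ := by
  have hquot : ∀ x ∈ Ioi c, HasDerivAt (fun x => χ x * x ^ (-κ)) 0 x := fun x hx => by
    have hx0 : 0 < x := hc.trans_lt hx
    refine ((hχ x hx).mul (Real.hasDerivAt_rpow_const (.inl hx0.ne'))).congr_deriv ?_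
    rw [Real.rpow_sub_one hx0.ne']
    ring
  obtain ⟨b, hb⟩ := isOpen_Ioi.exists_is_const_of_deriv_eq_zero isPreconnected_Ioi
    (fun x hx => (hquot x hx).differentiableAt.differentiableWithinAt)
    fun x hx => (hquot x hx).deriv
  refine ⟨b, fun x hx => ?_⟩
  have hx0 : 0 < x := hc.trans_lt hx
  rw [← hb x hx, mul_assoc, ← Real.rpow_add hx0, neg_add_cancel, Real.rpow_zero, mul_one]

theorem exists_eq_add_mul_rpow_of_mul_deriv_eq {κ d : ℝ} (hc : 0 ≤ c)
    (hd : ∀ x, c < x → DifferentiableAt ℝ φ x) (hpos : ∀ x, c < x → 0 < deriv φ x)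
    (hmono : MonotoneOn (deriv φ) (Ioi c)) (h : ∀ x, c < x → x * deriv φ x = κ * φ x + d) :
    ∃ κ b a : ℝ, 1 ≤ κ ∧ 0 < b ∧ ∀ x, c < x → φ x = a + b * x ^ κ := by
  obtain ⟨b, hb⟩ := exists_eq_mul_rpow_of_hasDerivAt (χ := fun x => κ * φ x + d) (κ := κ) hc
    fun x hx => by
      refine (((hd x hx).hasDerivAt.const_mul κ).add_const d).congr_deriv ?_
      rw [← h x hx, mul_div_assoc, mul_div_cancel_left₀ _ (hc.trans_lt hx).ne']
  have hderiv : ∀ x, c < x → deriv φ x = b * x ^ (κ - 1) := fun x hx => by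
    have hx0 : x ≠ 0 := (hc.trans_lt hx).ne'
    rw [Real.rpow_sub_one hx0, mul_div_assoc', eq_div_iff hx0, mul_comm, h x hx, hb x hx]
  obtain ⟨z, hz⟩ : ∃ z, c < z := exists_gt c
  obtain ⟨y, hzy⟩ : ∃ y, z < y := exists_gt z
  have hz0 : 0 < z := hc.trans_lt hz
  have hb0 : 0 < b := by
    have := hpos z hz
    rw [hderiv z hz] at this
    exact pos_of_mul_pos_left this (Real.rpow_nonneg hz0.le _)
  have hκ : 1 ≤ κ := by
    by_contra! hκ
    have hle := hmono hz (hz.trans hzy) hzy.le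
    rw [hderiv z hz, hderiv y (hz.trans hzy)] at hle
    exact hle.not_gt
      (mul_lt_mul_of_pos_left (Real.rpow_lt_rpow_of_neg hz0 hzy (sub_neg.2 hκ)) hb0)
  have hκ0 : 0 < κ := zero_lt_one.trans_le hκ
  refine ⟨κ, b / κ, -d / κ, hκ, div_pos hb0 hκ0, fun x hx => ?_⟩
  rw [div_mul_eq_mul_div, ← add_div, eq_div_iff hκ0.ne', ← hb x hx]
  ring

theorem exists_eq_add_mul_rpow_of_tangentValue_eq_iff {h : ℝ → ℝ} {s : ℝ} (hc : 0 ≤ c)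
    (hconv : ConvexOn ℝ (Ici 0) φ) (hmono : StrictMonoOn φ (Ici 0))
    (hd : ∀ x, 0 < x → DifferentiableAt ℝ φ x)
    (hlevel : ∀ x y ζ η, c < x → c < y → 0 ≤ ζ → 0 ≤ η →
      (tangentValue φ x ζ = tangentValue φ y η ↔ x ^ s * h ζ = y ^ s * h η)) :
    ∃ κ b a : ℝ, 1 ≤ κ ∧ 0 < b ∧ ∀ x, c < x → φ x = a + b * x ^ κ := by
  have hIci : Ioi c ⊆ Ici 0 := fun x hx => hc.trans (le_of_lt hx)
  have hd' : ∀ x, c < x → DifferentiableAt ℝ φ x := fun x hx => hd x (hc.trans_lt hx)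
  have hpos : ∀ x, c < x → 0 < deriv φ x := fun x hx =>
    deriv_pos_of_convexOn hconv hmono (hc.trans_lt hx) (hd' x hx)
  have hratio : ∀ x t, c < x → c < t * x →
      ∃ ζ, 0 ≤ ζ ∧ tangentValue φ x ζ = φ (t * x) ∧ h ζ = t ^ s * h 1 := fun x t hx htx => by
    have hx0 : 0 < x := hc.trans_lt hx
    have ht : 0 < t := pos_of_mul_pos_left (hc.trans_lt htx) hx0.le
    obtain ⟨ζ, hζ, htan⟩ := exists_tangentValue_eq hconv hx0 (hd' x hx) (hpos x hx) (hIci htx)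
    refine ⟨ζ, hζ, htan, mul_left_cancel₀ (Real.rpow_pos_of_pos hx0 s).ne' ?_⟩
    rw [(hlevel x (t * x) ζ 1 hx htx hζ zero_le_one).1 (by rw [htan, tangentValue_one]),
      Real.mul_rpow ht.le hx0.le]
    ring
  obtain ⟨κ, d, hκ⟩ := exists_eq_mul_add_of_dilation (ψ := fun x => x * deriv φ x) hc
    (hmono.injOn.mono hIci) fun x y t hx hy htx hty => by
      obtain ⟨ζ, hζ, htanζ, hhζ⟩ := hratio x t hx htx
      obtain ⟨η, hη, htanη, hhη⟩ := hratio y t hy hty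
      have hζη : ζ = η := tangentValue_injective (mul_pos (hc.trans_lt hx) (hpos x hx)).ne'
        ((hlevel x x ζ η hx hx hζ hη).2 (by rw [hhζ, hhη]))
      rw [← htanζ, ← htanη, hζη, tangentValue, tangentValue]
      ring
  exact exists_eq_add_mul_rpow_of_mul_deriv_eq hc hd' hpos
    ((hconv.subset hIci (convex_Ioi c)).monotoneOn_deriv hd') hκ

theorem tangentValue_eq_of_forall_gt {a b κ : ℝ} (hx : 0 < x) (hd : DifferentiableAt ℝ φ x)
    (h : ∀ y, x < y → φ y = a + b * y ^ κ) (ζ : ℝ) :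
    tangentValue φ x ζ = a + b * (x ^ κ * (1 + κ * (ζ - 1))) := by
  have hpow : HasDerivAt (fun y => a + b * y ^ κ) (b * (κ * x ^ (κ - 1))) x :=
    ((Real.hasDerivAt_rpow_const (.inl hx.ne')).const_mul b).const_add a
  have hφx : φ x = a + b * x ^ κ :=
    tendsto_nhds_unique (l := 𝓝[>] x) (hd.continuousAt.mono_left nhdsWithin_le_nhds)
      ((hpow.continuousAt.mono_left nhdsWithin_le_nhds).congr'
        (eventually_mem_nhdsWithin.mono fun y hy => (h y hy).symm))
  have hderiv : deriv φ x = b * (κ * x ^ (κ - 1)) :=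
    (uniqueDiffWithinAt_Ioi x).eq_deriv _ hd.hasDerivAt.hasDerivWithinAt
      (hpow.hasDerivWithinAt.congr (fun y hy => h y hy) hφx)
  rw [tangentValue, hφx, hderiv, Real.rpow_sub_one hx.ne']
  field_simp
  ring

end PowerLaw

section CrossEntropies

/-- `d` and `d'` have the same level sets on their common domain: weak equivalence without the
order of the levels. -/
def SameLevels {X : Type*} (d d' : PairFunctional X) : Prop :=
  ∀ z ∈ d.dom ∩ d'.dom, ∀ z' ∈ d.dom ∩ d'.dom,
    (d.val z.1 z.2 = d.val z'.1 z'.2 ↔ d'.val z.1 z.2 = d'.val z'.1 z'.2)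

theorem WeaklyEquivalent.sameLevels {X : Type*} {d d' : PairFunctional X}
    (h : WeaklyEquivalent d d') : SameLevels d d' := by
  obtain ⟨ξ, hξ, hval⟩ := h
  intro z hz z' hz'
  rw [hval _ _ hz.1 hz.2, hval _ _ hz'.1 hz'.2]
  exact (hξ.injOn.eq_iff ⟨_, _, hz.1, hz.2, rfl⟩ ⟨_, _, hz'.1, hz'.2, rfl⟩).symm

variable {X : Type*} [MeasurableSpace X] {ν : Measure X} {φ : ℝ → ℝ → ℝ} {H : ℝ → ℝ}
  {γ γ' κ : ℝ} {q p : X → ℝ}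

theorem nbCE_dom_of_pos (hγ : 0 < γ) :
    (nbCE ν φ γ).dom = DensityClass ν γ ×ˢ DensityClass ν γ :=
  if_neg hγ.ne'

theorem nbCE_val_of_pos (hγ : 0 < γ) (hp : p ∈ DensityClass ν γ) :
    (nbCE ν φ γ).val q p =
      -(tangentValue (φ γ) (lnorm ν γ p) (crossInt ν γ q p / powInt ν γ p) - φ 0 1) / γ := by
  have hN := lnorm_pos hγ hp
  have hNγ := (Real.rpow_pos_of_pos hN γ).ne'
  have hpow : powInt ν γ p = lnorm ν γ p * lnorm ν γ p ^ γ := by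
    rw [← lnorm_rpow hγ hp.1, Real.rpow_add hN, Real.rpow_one]
  simp only [nbCE, if_neg hγ.ne', tangentValue, hpow]
  field [hN.ne', hNγ]

theorem bregmanHolderCE_val (hκ : κ ≠ 0) :
    (bregmanHolderCE ν κ γ).val q p =
      (1 - lnorm ν γ p ^ κ * (1 + κ * (crossInt ν γ q p / powInt ν γ p - 1))) / γ := by
  simp only [bregmanHolderCE]
  field

theorem holderCE_val (hγ : 0 < γ) (hp : IsDensity ν p) :
    (holderCE ν H γ).val q p =
      (1 + lnorm ν γ p ^ (1 + γ) * H (crossInt ν γ q p / powInt ν γ p)) / γ := by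
  simp only [holderCE, lnorm_rpow hγ hp]
  ring

theorem IsNBGenerator.differentiableAt (hφ : IsNBGenerator φ γ) {g x : ℝ} (hg : 0 ≤ g)
    (hx : 0 < x) : DifferentiableAt ℝ (φ g) x :=
  (hφ.differentiableOn g hg).differentiableAt (Ioi_mem_nhds hx)

theorem IsNBGenerator.deriv_pos (hφ : IsNBGenerator φ γ) {g x : ℝ} (hg : 0 ≤ g) (hx : 0 < x) :
    0 < deriv (φ g) x :=
  deriv_pos_of_convexOn (hφ.convexOn g hg) (hφ.strictMonoOn g hg) hx (hφ.differentiableAt hg hx)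

theorem exists_equivalent_bregmanHolderCE_of_sameLevels (hν : HasIntermediateMeasures ν)
    (hν0 : ν ≠ 0) (hγ : 0 < γ) (hφ : IsNBGenerator φ γ)
    (h : SameLevels (nbCE ν φ γ) (holderCE ν H γ)) :
    ∃ κ : ℝ, 1 ≤ κ ∧ Equivalent (bregmanHolderCE ν κ γ) (nbCE ν φ γ) := by
  have hdom : ∀ q ∈ DensityClass ν γ, ∀ p ∈ DensityClass ν γ,
      (q, p) ∈ (nbCE ν φ γ).dom ∩ (holderCE ν H γ).dom := fun q hq p hp => by
    rw [nbCE_dom_of_pos hγ]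
    exact ⟨⟨hq, hp⟩, hq, hp⟩
  obtain ⟨κ, b, a, hκ, hb, hpow⟩ := exists_eq_add_mul_rpow_of_tangentValue_eq_iff
    (h := H) (s := 1 + γ) (minNorm_nonneg (ν := ν) (γ := γ)) (hφ.convexOn γ hγ.le)
    (hφ.strictMonoOn γ hγ.le) (fun x hx => hφ.differentiableAt hγ.le hx)
    fun x y ζ η hx hy hζ hη => by
      obtain ⟨q, p, hq, hp, hpx, hqp⟩ := exists_lnorm_eq_crossInt_div_powInt_eq hν hν0 hγ hx hζ
      obtain ⟨q', p', hq', hp', hpy, hqp'⟩ :=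
        exists_lnorm_eq_crossInt_div_powInt_eq hν hν0 hγ hy hη
      have hlevel := h _ (hdom q hq p hp) _ (hdom q' hq' p' hp')
      simpa only [nbCE_val_of_pos hγ hp, nbCE_val_of_pos hγ hp', holderCE_val hγ hp.1,
        holderCE_val hγ hp'.1, hpx, hqp, hpy, hqp', div_left_inj' hγ.ne', neg_inj, sub_left_inj,
        add_right_inj] using hlevel
  refine ⟨κ, hκ, fun y => b * y - (a + b - φ 0 1) / γ,
    fun y z hyz => sub_lt_sub_right (mul_lt_mul_of_pos_left hyz hb) _, ?_⟩
  rintro q p ⟨-, hp : p ∈ DensityClass ν γ⟩ -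
  have hN := lnorm_pos hγ hp
  rw [nbCE_val_of_pos hγ hp, bregmanHolderCE_val (by positivity),
    tangentValue_eq_of_forall_gt hN (hφ.differentiableAt hγ.le hN) fun y hy =>
      hpow y ((minNorm_le_lnorm hγ hp).trans_lt hy)]
  ring

end CrossEntropies

section PowerParameter

/-- The function `G` for which a norm-based cross-entropy with parameter `γ` depends on `q` through
`⟨q G(p)⟩` only: a power, and the logarithm for `γ = 0`. -/
noncomputable def powerScore (γ : ℝ) : ℝ → ℝ :=
  if γ = 0 then Real.log else fun x => x ^ γ

theorem powerScore_convexCombination_ne {r x y α β : ℝ} (hr : 0 ≤ r) (hr1 : r ≠ 1) (hx : 0 < x)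
    (hy : 0 < y) (hxy : x ≠ y) (hα : 0 < α) (hβ : 0 < β) (hαβ : α + β = 1) :
    α * powerScore r x + β * powerScore r y ≠ powerScore r (α * x + β * y) := by
  rcases hr.eq_or_lt with rfl | hr0
  · simpa [powerScore] using (strictConcaveOn_log_Ioi.2 hx hy hxy hα hβ hαβ).ne
  · simp only [powerScore, if_neg hr0.ne']
    rcases hr1.lt_or_gt with hr1 | hr1
    · exact ((Real.strictConcaveOn_rpow hr0 hr1).2 hx.le hy.le hxy hα hβ hαβ).ne
    · exact ((strictConvexOn_rpow hr1).2 hx.le hy.le hxy hα hβ hαβ).ne'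

theorem exists_powerScore_div_rpow_eq_mul {γ γ' : ℝ} (hγ' : γ' ≠ 0) :
    ∃ k, ∀ x, 0 < x → powerScore (γ / γ') (x ^ γ') = k * powerScore γ x := by
  rcases eq_or_ne γ 0 with rfl | hγ
  · exact ⟨γ', fun x hx => by simp [powerScore, Real.log_rpow hx]⟩
  · refine ⟨1, fun x hx => ?_⟩
    simp only [powerScore, if_neg hγ, if_neg (div_ne_zero hγ hγ')]
    rw [← Real.rpow_mul hx.le, mul_div_cancel₀ _ hγ', one_mul]

theorem powerScore_mean_ne {γ γ' a b c α β : ℝ} (hγ : 0 ≤ γ) (hγ' : 0 < γ') (hne : γ ≠ γ')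
    (ha : 0 < a) (hb : 0 < b) (hc : 0 < c) (hac : a ≠ c) (hα : 0 < α) (hβ : 0 < β)
    (hαβ : α + β = 1) (hmean : α * a ^ γ' + β * c ^ γ' = b ^ γ') :
    α * powerScore γ a + β * powerScore γ c ≠ powerScore γ b := by
  obtain ⟨k, hpow⟩ := exists_powerScore_div_rpow_eq_mul (γ := γ) hγ'.ne'
  have h := powerScore_convexCombination_ne (div_nonneg hγ hγ'.le)
    (fun h => hne ((div_eq_one_iff_eq hγ'.ne').1 h)) (Real.rpow_pos_of_pos ha γ')
    (Real.rpow_pos_of_pos hc γ')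
    (fun h => hac ((Real.rpow_left_inj ha.le hc.le hγ'.ne').1 h)) hα hβ hαβ
  rw [hmean, hpow a ha, hpow b hb, hpow c hc, mul_left_comm, mul_left_comm β, ← mul_add] at h
  exact fun heq => h (congrArg (k * ·) heq)

variable {X : Type*} [MeasurableSpace X] {ν : Measure X} {φ : ℝ → ℝ → ℝ} {H : ℝ → ℝ}
  {γ γ' : ℝ} {p q₁ q₂ : X → ℝ}

theorem nbCE_val_eq_iff (hγ : 0 ≤ γ) (hφ : IsNBGenerator φ γ) (h : (q₁, p) ∈ (nbCE ν φ γ).dom) :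
    (nbCE ν φ γ).val q₁ p = (nbCE ν φ γ).val q₂ p ↔
      ∫ x, q₁ x * powerScore γ (p x) ∂ν = ∫ x, q₂ x * powerScore γ (p x) ∂ν := by
  rcases hγ.eq_or_lt with rfl | hγ
  · simp [nbCE, powerScore, (hφ.deriv_pos le_rfl one_pos).ne']
  · rw [nbCE_dom_of_pos hγ] at h
    have hp : p ∈ DensityClass ν γ := h.2
    have hN := lnorm_pos hγ hp
    simp only [nbCE_val_of_pos hγ hp, tangentValue, powerScore, if_neg hγ.ne',
      div_left_inj' hγ.ne', neg_inj, sub_left_inj, add_right_inj,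
      mul_right_inj' (mul_pos hN (hφ.deriv_pos hγ.le hN)).ne', div_left_inj' (powInt_pos hγ hp).ne',
      crossInt]

theorem holderCE_val_congr (h : crossInt ν γ q₁ p = crossInt ν γ q₂ p) :
    (holderCE ν H γ).val q₁ p = (holderCE ν H γ).val q₂ p := by
  simp only [holderCE, h]

theorem IsDisjointCells.mixture_mem_nbCE_dom {ι : Type*} [Fintype ι] {A : ι → Set X}
    (hA : IsDisjointCells ν A) (hγ : 0 ≤ γ) {w u : ι → ℝ} (hw : w ∈ stdSimplex ℝ ι)
    (hu : u ∈ stdSimplex ℝ ι) (hu0 : ∀ i, u i ≠ 0) :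
    (mixture ν A w, mixture ν A u) ∈ (nbCE ν φ γ).dom := by
  rcases hγ.eq_or_lt with rfl | hγ
  · simp only [nbCE, if_true]
    refine ⟨hA.isDensity_mixture hw, hA.isDensity_mixture hu,
      .of_forall fun x (hx : mixture ν A u x = 0) => ?_,
      hA.integrable_mixture_mul_comp Real.log⟩
    refine mixture_of_forall_notMem fun i hi => ?_
    rw [hA.mixture_of_mem hi] at hx
    exact div_ne_zero (hu0 i) (hA.measureReal_pos i).ne' hx
  · rw [nbCE_dom_of_pos hγ]
    exact ⟨hA.mixture_mem_densityClass hγ hw, hA.mixture_mem_densityClass hγ hu⟩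

theorem HasIntermediateMeasures.exists_isDisjointCells_const (hν : HasIntermediateMeasures ν)
    (hν0 : ν ≠ 0) (ι : Type*) [Finite ι] :
    ∃ m, 0 < m ∧ ∃ A : ι → Set X, IsDisjointCells ν A ∧ ∀ i, ν.real (A i) = m := by
  have := Fintype.ofFinite ι
  obtain ⟨t, -, ht, htν⟩ := ENNReal.lt_iff_exists_real_btwn.1
    (pos_iff_ne_zero.2 (Measure.measure_univ_ne_zero.2 hν0))
  have hm : 0 < t / (Fintype.card ι + 1) := div_pos (ENNReal.ofReal_pos.1 ht) (by positivity)
  refine ⟨_, hm, hν.exists_isDisjointCells (fun _ => hm) (lt_of_le_of_lt ?_ htν)⟩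
  refine ENNReal.ofReal_le_ofReal ?_
  rw [Finset.sum_const, Finset.card_univ, nsmul_eq_mul, mul_div_assoc', div_le_iff₀ (by positivity)]
  linarith [ENNReal.ofReal_pos.1 ht]

theorem power_eq_of_sameLevels (hν : HasIntermediateMeasures ν) (hν0 : ν ≠ 0) (hγ : 0 ≤ γ)
    (hγ' : 0 < γ') (hφ : IsNBGenerator φ γ) (h : SameLevels (nbCE ν φ γ) (holderCE ν H γ')) :
    γ = γ' := by
  by_contra hne
  obtain ⟨m, hm, A, hA, hAm⟩ := hν.exists_isDisjointCells_const hν0 (Fin 3)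
  have hvalues : (1 / 3 / m) ^ γ' ∈ Ioo ((1 / 6 / m) ^ γ') ((1 / 2 / m) ^ γ') := by
    constructor <;> gcongr <;> norm_num
  rw [← openSegment_eq_Ioo (hvalues.1.trans hvalues.2)] at hvalues
  obtain ⟨α, β, hα, hβ, hαβ, hmean⟩ := hvalues
  have hu : ![1 / 6, 1 / 3, 1 / 2] ∈ stdSimplex ℝ (Fin 3) :=
    ⟨by simp [Fin.forall_fin_succ], by norm_num [Fin.sum_univ_succ]⟩
  have hw₁ : ![0, 1, 0] ∈ stdSimplex ℝ (Fin 3) :=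
    ⟨by simp [Fin.forall_fin_succ], by simp [Fin.sum_univ_three]⟩
  have hw₂ : ![α, 0, β] ∈ stdSimplex ℝ (Fin 3) :=
    ⟨by simp [Fin.forall_fin_succ, hα.le, hβ.le], by simp [Fin.sum_univ_three, hαβ]⟩
  have hdom : ∀ w ∈ stdSimplex ℝ (Fin 3), (mixture ν A w, mixture ν A ![1 / 6, 1 / 3, 1 / 2]) ∈
      (nbCE ν φ γ).dom ∩ (holderCE ν H γ').dom := fun w hw =>
    ⟨hA.mixture_mem_nbCE_dom hγ hw hu (by simp [Fin.forall_fin_succ]),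
      hA.mixture_mem_densityClass hγ' hw, hA.mixture_mem_densityClass hγ' hu⟩
  have hcross : crossInt ν γ' (mixture ν A ![α, 0, β]) (mixture ν A ![1 / 6, 1 / 3, 1 / 2]) =
      crossInt ν γ' (mixture ν A ![0, 1, 0]) (mixture ν A ![1 / 6, 1 / 3, 1 / 2]) := by
    rw [hA.crossInt_mixture, hA.crossInt_mixture]
    simpa [Fin.sum_univ_three, hAm] using hmean
  have hscore := (h _ (hdom _ hw₂) _ (hdom _ hw₁)).2 (holderCE_val_congr hcross)
  rw [nbCE_val_eq_iff hγ hφ (hdom _ hw₂).1, hA.integral_mixture_mul_comp,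
    hA.integral_mixture_mul_comp] at hscore
  refine powerScore_mean_ne hγ hγ' hne (a := 1 / 6 / m) (b := 1 / 3 / m) (c := 1 / 2 / m)
    (by positivity) (by positivity) (by positivity) 
    (by rw [Ne, div_left_inj' hm.ne']; norm_num) hα hβ hαβ hmean ?_
  simpa [Fin.sum_univ_three, hAm] using hscore

end PowerParameter

section Converse

variable {X : Type*} [MeasurableSpace X] {ν : Measure X} {γ κ : ℝ}

theorem exists_nbCE_equivalent (hγ : 0 < γ) (hκ : 1 ≤ κ) :
    ∃ φ : ℝ → ℝ → ℝ, IsNBGenerator φ γ ∧ Equivalent (bregmanHolderCE ν κ γ) (nbCE ν φ γ) := by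
  have hd : ∀ x : ℝ, 0 < x → DifferentiableAt ℝ (fun x : ℝ => x ^ κ) x := fun x hx =>
    Real.differentiableAt_rpow_const_of_ne κ hx.ne'
  refine ⟨fun _ x => x ^ κ, ⟨fun _ _ => Real.strictMonoOn_rpow_Ici_of_exponent_pos (by positivity),
    fun _ _ => convexOn_rpow hκ, fun _ _ x hx => (hd x hx).differentiableWithinAt,
    fun h => absurd h hγ.ne'⟩, id, strictMono_id, ?_⟩
  rintro q p ⟨-, hp : p ∈ DensityClass ν γ⟩ -
  have hN := lnorm_pos hγ hp
  rw [nbCE_val_of_pos hγ hp, bregmanHolderCE_val (by positivity),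
    tangentValue_eq_of_forall_gt (κ := κ) (a := 0) (b := 1) hN (hd _ hN) (by simp),
    Real.one_rpow, id]
  ring

/-- The power function `x ↦ x ^ r` on `[0, ∞)`, extended to `ℝ` as an odd function. -/
noncomputable def oddRpow (r x : ℝ) : ℝ :=
  SignType.sign x * |x| ^ r

theorem oddRpow_of_nonneg {r x : ℝ} (hr : r ≠ 0) (hx : 0 ≤ x) : oddRpow r x = x ^ r := by
  rcases hx.eq_or_lt with rfl | hx
  · simp [oddRpow, Real.zero_rpow hr]
  · simp [oddRpow, sign_pos hx, abs_of_pos hx]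

theorem strictMono_oddRpow {r : ℝ} (hr : 0 < r) : StrictMono (oddRpow r) := by
  refine strictMono_of_odd_strictMonoOn_nonneg (fun x => ?_) fun x hx y hy hxy => ?_
  · simp [oddRpow, Left.sign_neg]
  · rw [oddRpow_of_nonneg hr.ne' hx, oddRpow_of_nonneg hr.ne' hy]
    exact Real.rpow_lt_rpow hx hxy hr

theorem oddRpow_mul {r x y : ℝ} (hx : 0 < x) : oddRpow r (x * y) = x ^ r * oddRpow r y := by
  simp only [oddRpow, sign_mul, sign_pos hx, one_mul, abs_mul, abs_of_pos hx,
    Real.mul_rpow hx.le (abs_nonneg y)]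
  ring

theorem isHolderGenerator_neg_oddRpow (hγ : 0 < γ) (hκ : 1 ≤ κ) :
    IsHolderGenerator (fun z => -oddRpow ((1 + γ) / κ) (1 + κ * (z - 1))) γ := by
  have hr : 0 < (1 + γ) / κ := by positivity
  refine ⟨fun z hz => neg_le_neg ?_, by simp [oddRpow]⟩
  have hbernoulli := one_add_mul_self_le_rpow_one_add (s := z - 1) (by linarith) hκ
  rw [add_sub_cancel] at hbernoulli
  calc
    oddRpow ((1 + γ) / κ) (1 + κ * (z - 1)) ≤ oddRpow ((1 + γ) / κ) (z ^ κ) :=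
      (strictMono_oddRpow hr).monotone hbernoulli
    _ = z ^ (1 + γ) := by
      rw [oddRpow_of_nonneg hr.ne' (Real.rpow_nonneg hz κ), ← Real.rpow_mul hz,
        mul_div_cancel₀ _ (by positivity)]

theorem exists_holderCE_equivalent (hγ : 0 < γ) (hκ : 1 ≤ κ) :
    ∃ H : ℝ → ℝ, IsHolderGenerator H γ ∧
      Equivalent (bregmanHolderCE ν κ γ) (holderCE ν H γ) := by
  have hr : 0 < (1 + γ) / κ := by positivity
  refine ⟨_, isHolderGenerator_neg_oddRpow hγ hκ,
    fun y => (1 - oddRpow ((1 + γ) / κ) (1 - γ * y)) / γ, fun x y hxy => ?_, ?_⟩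
  · exact div_lt_div_of_pos_right (sub_lt_sub_left (strictMono_oddRpow hr
      (sub_lt_sub_left (mul_lt_mul_of_pos_left hxy hγ) 1)) 1) hγ
  · rintro q p ⟨-, hp⟩ -
    have hN := lnorm_pos hγ hp
    dsimp only
    rw [holderCE_val hγ hp.1, bregmanHolderCE_val (by positivity), mul_div_cancel₀ _ hγ.ne',
      sub_sub_cancel, oddRpow_mul (Real.rpow_pos_of_pos hN κ), ← Real.rpow_mul hN.le,
      mul_div_cancel₀ _ (by positivity)]
    ring

end Converse

end NBDPD

theorem corollary1_general {X : Type*} [MeasurableSpace X] {ν : Measure X}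
    (hν : NBDPD.HasIntermediateMeasures ν) (hν0 : ν ≠ 0) :
    (∀ (γ γ' : ℝ) (φ : ℝ → ℝ → ℝ) (H : ℝ → ℝ), 0 ≤ γ → 0 < γ' → NBDPD.IsNBGenerator φ γ →
      NBDPD.SameLevels (NBDPD.nbCE ν φ γ) (NBDPD.holderCE ν H γ') →
      γ = γ' ∧ ∃ κ : ℝ, 1 ≤ κ ∧
        NBDPD.Equivalent (NBDPD.bregmanHolderCE ν κ γ) (NBDPD.nbCE ν φ γ)) ∧
    (∀ γ κ : ℝ, 0 < γ → 1 ≤ κ →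
      (∃ φ : ℝ → ℝ → ℝ, NBDPD.IsNBGenerator φ γ ∧
        NBDPD.Equivalent (NBDPD.bregmanHolderCE ν κ γ) (NBDPD.nbCE ν φ γ)) ∧
      (∃ H : ℝ → ℝ, NBDPD.IsHolderGenerator H γ ∧
        NBDPD.Equivalent (NBDPD.bregmanHolderCE ν κ γ) (NBDPD.holderCE ν H γ))) := by
  refine ⟨fun γ γ' φ H hγ hγ' hφ h => ?_, fun γ κ hγ hκ =>
    ⟨NBDPD.exists_nbCE_equivalent hγ hκ, NBDPD.exists_holderCE_equivalent hγ hκ⟩⟩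
  obtain rfl := NBDPD.power_eq_of_sameLevels hν hν0 hγ hγ' hφ h
  exact ⟨rfl, NBDPD.exists_equivalent_bregmanHolderCE_of_sameLevels hν hν0 hγ' hφ h⟩

theorem corollary1 (n : ℕ) (hn : 1 ≤ n) (S : Set (EuclideanSpace ℝ (Fin n)))
    (hS : MeasurableSet S) (hS0 : volume S ≠ 0) :
    -- a common member of the two classes is a Bregman–Hölder cross-entropy
    (∀ (γ γ' : ℝ) (φ : ℝ → ℝ → ℝ) (H : ℝ → ℝ), 0 ≤ γ → 0 < γ' →
      NBDPD.IsNBGenerator φ γ → NBDPD.IsHolderGenerator H γ' →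
      NBDPD.WeaklyEquivalent (NBDPD.nbCE (volume.restrict S) φ γ)
        (NBDPD.holderCE (volume.restrict S) H γ') →
      γ = γ' ∧ ∃ κ : ℝ, 1 ≤ κ ∧
        NBDPD.Equivalent (NBDPD.bregmanHolderCE (volume.restrict S) κ γ)
          (NBDPD.nbCE (volume.restrict S) φ γ)) ∧
    -- every Bregman–Hölder cross-entropy is a common member
    (∀ γ κ : ℝ, 0 < γ → 1 ≤ κ →
      (∃ φ : ℝ → ℝ → ℝ, NBDPD.IsNBGenerator φ γ ∧
        NBDPD.Equivalent (NBDPD.bregmanHolderCE (volume.restrict S) κ γ)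
          (NBDPD.nbCE (volume.restrict S) φ γ)) ∧
      (∃ H : ℝ → ℝ, NBDPD.IsHolderGenerator H γ ∧
        NBDPD.Equivalent (NBDPD.bregmanHolderCE (volume.restrict S) κ γ)
          (NBDPD.holderCE (volume.restrict S) H γ))) := by
  have : Nonempty (Fin n) := Fin.pos_iff_nonempty.1 hn
  have h := corollary1_general (NBDPD.hasIntermediateMeasures_addHaar_restrict volume S)
    (mt Measure.restrict_eq_zero.1 hS0)
  exact ⟨fun γ γ' φ H hγ hγ' hφ _ hw => h.1 γ γ' φ H hγ hγ' hφ hw.sameLevels, h.2⟩
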